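/- \textbf{Theorem (M\"obius Representation).} Let $X$ be a countable (finite or countably infinite) set with at least $3$ elements. The \emph{Cox configuration} over $X$ is the incidence structure whose points are the finite subsets of $X$ of even cardinality (including $\emptyset$), whose blocks are the finite subsets of $X$ of odd cardinality, and in which a point $a$ and a block $b$ are incident if and only if one of $a,b$ arises from the other by adding exactly one element of $X$. Then the Cox configuration over $X$ can be realized on a $2$-sphere in Euclidean $3$-space, with its blocks interpreted as circles. That is, there are a sphere $\mathcal S\subset\mathbb R^3$ of positive radius, an injective map $f$ from the points of the configuration to points of $\mathcal S$, and an injective map $g$ from its blocks to circles on $\mathcal S$ (sections of $\mathcal S$ by planes that contain more than one point), such that, for every point $a$ and every block $b$, $a$ is incident with $b$ if and only if $f(a)\in g(b)$. -/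

import Mathlib

/-- An incidence structure: points, blocks and an incidence relation between them. -/
structure PBIncidence.{u, v} where
  Point : Type u
  Block : Type v
  Inc : Point → Block → Prop

/-- A realization of `K` in `M`: points go to points and blocks go to blocks, distinct objects to
distinct objects, and a point is incident with a block of `K` exactly when their images are
incident in `M` (so the image is an isomorphic copy of `K` inside `M`). -/
structure PBIncidence.Realization (K M : PBIncidence) where
  onPoint : K.Point → M.Point
  onBlock : K.Block → M.Block
  onPoint_injective : Function.Injective onPoint
  onBlock_injective : Function.Injective onBlock
  inc_iff : ∀ (p : K.Point) (b : K.Block), K.Inc p b ↔ M.Inc (onPoint p) (onBlock b)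

/-- The Cox configuration over `X`: points are the finite subsets of `X` of even cardinality,
blocks are the finite subsets of odd cardinality, and `a`, `b` are incident when one of them
is a direct successor of the other with respect to inclusion. -/
def coxConfiguration (X : Type*) : PBIncidence where
  Point := {a : Finset X // Even a.card}
  Block := {b : Finset X // Odd b.card}
  Inc a b := a.1 ⋖ b.1 ∨ b.1 ⋖ a.1

/-- A circle on a sphere of Euclidean 3-space: a plane section with more than one point. -/
def IsCircleOn (S : EuclideanGeometry.Sphere (EuclideanSpace ℝ (Fin 3)))
    (C : Set (EuclideanSpace ℝ (Fin 3))) : Prop :=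
  C.Nontrivial ∧ ∃ P : AffineSubspace ℝ (EuclideanSpace ℝ (Fin 3)),
    Module.finrank ℝ P.direction = 2 ∧ C = {x | x ∈ P ∧ x ∈ S}

/-- The incidence structure of the points and the circles of a sphere. -/
def sphereCircles (S : EuclideanGeometry.Sphere (EuclideanSpace ℝ (Fin 3))) : PBIncidence where
  Point := {x : EuclideanSpace ℝ (Fin 3) // x ∈ S}
  Block := {C : Set (EuclideanSpace ℝ (Fin 3)) // IsCircleOn S C}
  Inc x C := x.1 ∈ C.1

/-!
The configuration is realized by rational interpolation. Fix distinct real nodes `τ x`, `x ∈ X`,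
and attach to each node a pair `c x = (u, v)` of real numbers. A pair of real polynomials `(P, Q)`
interpolates the data at `x` if `v P(τ x) + u Q(τ x) = 0`, that is, if `-P/Q` takes the value `u/v`
there. Bound the degrees by `PairDegreeLT N`, which leaves `N` coefficients in all.

* A set `a` of nodes and `N = |a| + 1` give a homogeneous linear system with one more unknown than
  equations. Its solution by cofactors is `interpolant`, and the point of `a` is the value
  `[U : V] = [P(i) : -Q(i)]` in the complex projective line, a 2-sphere (`hopf`).
* A set `b` of nodes and `N = |b| + 2` leave two equations over: ask that `(P, Q)` also takes the
  value `[u : v]` at `i`, a complex and hence two real conditions. The determinant `hermForm` of the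
  square system is a Hermitian form in `(u, v)`, so its zeros are a plane section of the sphere.
  This is the circle of `b`.

If `a` and `b` differ by one node, the point of `a` lies on the circle of `b`: the interpolant
`(P, Q)` of `a`, or its multiple by `t - τ x` when `b = a ∪ {x}`, solves the system of `b`
(`hermForm_point_of_insert`, `hermForm_point_insert`).

If `a` and `b` differ by at least three nodes, the incidence determinant is a polynomial in the
data `c` that does not vanish identically: it is nonzero for suitable data with values
`u/v ∈ {0, ∞}`, where everything reduces to counting zeros (`exists_hermForm_point_ne_zero`). As
there are countably many pairs `(a, b)`, the Baire category theorem in `X → ℝ × ℝ` yields data for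
which no unwanted incidence occurs (`exists_generic_data`).

Since `X` has at least three elements, an object of the Cox configuration is determined by the
objects incident with it, and every object has some object of the other kind that is not incident
with it. So the equivalence of the incidences alone implies that points and circles are well
defined, nondegenerate and pairwise distinct (`nonempty_realization`).
-/

open Polynomial
open scoped Matrix symmDiff InnerProductSpace

/-! ### Pairs of polynomials of bounded degree -/

/-- A real polynomial vanishing at `i` also vanishes at `-i`, so it has two zeros besides
the given real ones. -/
theorem eq_zero_of_aeval_I_eq_zero {P : ℝ[X]} (s : Finset ℝ) (hs : ∀ t ∈ s, P.eval t = 0)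
    (hI : aeval Complex.I P = 0) (hP : P.degree < (s.card + 2 : ℕ)) : P = 0 := by
  have hI' : aeval (-Complex.I) P = 0 := by
    have := congrArg (starRingEnd ℂ) hI
    rw [map_zero, ← aeval_conj] at this
    simpa using this
  refine (Polynomial.map_eq_zero (algebraMap ℝ ℂ)).1 ?_
  refine eq_zero_of_degree_lt_of_eval_index_eq_zero
    (v := Sum.elim (fun t : ℝ => (t : ℂ)) ![Complex.I, -Complex.I])
    (s.disjSum (Finset.univ : Finset (Fin 2))) ?_ ?_ ?_
  · refine Function.Injective.injOn (Function.Injective.sumElim Complex.ofReal_injective ?_ ?_)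
    · intro i j h
      fin_cases i <;> fin_cases j <;> simp [Complex.ext_iff] at h ⊢ <;> norm_num at h
    · intro t j h
      fin_cases j <;> simp [Complex.ext_iff] at h
  · rw [degree_map]
    simpa using hP
  · intro i hi
    rcases i with t | j
    · simp only [Finset.inl_mem_disjSum] at hi
      have := hs t hi
      simp [eval_map_algebraMap]
      rw [show (t : ℂ) = algebraMap ℝ ℂ t from rfl, aeval_algebraMap_apply]
      simp [this]
    · fin_cases j <;> simpa [eval_map_algebraMap]

/-- The interpolation condition at the real node `t` for the data `c = (u, v)`: the linear form
`(P, Q) ↦ v P(t) + u Q(t)`. Homogeneous data allow the value `∞`, which is `v = 0`. -/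
noncomputable def nodeForm (t : ℝ) (c : ℝ × ℝ) : Module.Dual ℝ (ℝ[X] × ℝ[X]) :=
  c.2 • (leval t ∘ₗ LinearMap.fst ℝ ℝ[X] ℝ[X]) + c.1 • (leval t ∘ₗ LinearMap.snd ℝ ℝ[X] ℝ[X])

@[simp] theorem nodeForm_apply (t : ℝ) (c : ℝ × ℝ) (F : ℝ[X] × ℝ[X]) :
    nodeForm t c F = c.2 * F.1.eval t + c.1 * F.2.eval t := by
  simp [nodeForm]

/-- The interpolation condition at the node `i` with value `[u : v]`: the complex-valued form
`(P, Q) ↦ v P(i) + u Q(i)`. -/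
noncomputable def imagForm (u v : ℂ) : (ℝ[X] × ℝ[X]) →ₗ[ℝ] ℂ :=
  v • ((aeval Complex.I).toLinearMap ∘ₗ LinearMap.fst ℝ ℝ[X] ℝ[X]) +
    u • ((aeval Complex.I).toLinearMap ∘ₗ LinearMap.snd ℝ ℝ[X] ℝ[X])

@[simp] theorem imagForm_apply (u v : ℂ) (F : ℝ[X] × ℝ[X]) :
    imagForm u v F = v * aeval Complex.I F.1 + u * aeval Complex.I F.2 := by
  simp [imagForm]

/-- The degree bounds on `(P, Q)` leaving `⌈N / 2⌉` coefficients to `P` and `⌊N / 2⌋` to `Q`, so `N`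
in all. Raising `N` by two admits the multiples by a linear factor. -/
def PairDegreeLT (N : ℕ) (F : ℝ[X] × ℝ[X]) : Prop :=
  F.1.degree < ((N + 1) / 2 : ℕ) ∧ F.2.degree < (N / 2 : ℕ)

/-- An index set for the coefficients of the pairs subject to `PairDegreeLT N`. -/
abbrev PairIndex (N : ℕ) : Type := Fin ((N + 1) / 2) ⊕ Fin (N / 2)

/-- The monomial basis of the pairs subject to `PairDegreeLT N`. -/
noncomputable def monomialPair {N : ℕ} : PairIndex N → ℝ[X] × ℝ[X] :=
  Sum.elim (fun i => (X ^ (i : ℕ), 0)) (fun i => (0, X ^ (i : ℕ)))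

theorem sum_smul_monomialPair {N : ℕ} (y : PairIndex N → ℝ) :
    ∑ k, y k • monomialPair k =
      (∑ i, C (y (Sum.inl i)) * X ^ (i : ℕ), ∑ i, C (y (Sum.inr i)) * X ^ (i : ℕ)) := by
  rw [Fintype.sum_sum_type]
  simp [monomialPair, Prod.ext_iff, Prod.fst_sum, Prod.snd_sum, smul_eq_C_mul]

theorem pairDegreeLT_sum {N : ℕ} (y : PairIndex N → ℝ) :
    PairDegreeLT N (∑ k, y k • monomialPair k) := by
  rw [sum_smul_monomialPair]
  exact ⟨degree_sum_fin_lt _, degree_sum_fin_lt _⟩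

/-- The coefficients of a pair of polynomials below the bounds of `PairDegreeLT N`. -/
def pairCoeff (N : ℕ) (F : ℝ[X] × ℝ[X]) : PairIndex N → ℝ :=
  Sum.elim (fun i => F.1.coeff i) (fun i => F.2.coeff i)

theorem PairDegreeLT.eq_sum {N : ℕ} {F : ℝ[X] × ℝ[X]} (hF : PairDegreeLT N F) :
    F = ∑ k, pairCoeff N F k • monomialPair k := by
  have key : ∀ {n : ℕ} {p : ℝ[X]}, p.degree < n → p = ∑ i : Fin n, C (p.coeff i) * X ^ (i : ℕ) := by
    intro n p hp
    rw [sum_fin (fun i c => C c * X ^ i) (by simp) hp]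
    exact (sum_C_mul_X_pow_eq p).symm
  rw [sum_smul_monomialPair]
  exact Prod.ext (key hF.1) (key hF.2)

theorem sum_smul_monomialPair_eq_zero {N : ℕ} {y : PairIndex N → ℝ}
    (h : ∑ k, y k • monomialPair k = 0) : y = 0 := by
  rw [sum_smul_monomialPair, Prod.mk_eq_zero] at h
  funext k
  rcases k with i | i
  · have := congrArg (fun p => p.coeff (i : ℕ)) h.1
    simpa [finsetSum_coeff, coeff_C_mul, coeff_X_pow, Fin.val_inj] using this
  · have := congrArg (fun p => p.coeff (i : ℕ)) h.2
    simpa [finsetSum_coeff, coeff_C_mul, coeff_X_pow, Fin.val_inj] using this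

section formDet
variable {ι : Type*} [Fintype ι] [DecidableEq ι]

/-- An arbitrary numbering of the coefficients by a type with as many elements. -/
noncomputable def pairIndexEquiv (ι : Type*) [Fintype ι] : ι ≃ PairIndex (Fintype.card ι) :=
  Fintype.equivOfCardEq (by simp; omega)

/-- The determinant of as many linear forms as there are coefficients, in the monomial basis. The
choice of `pairIndexEquiv` affects only its sign. -/
noncomputable def formDet : (Module.Dual ℝ (ℝ[X] × ℝ[X])) [⋀^ι]→ₗ[ℝ] ℝ :=
  Matrix.detRowAlternating.compLinearMap
    (LinearMap.pi fun k => LinearMap.applyₗ (monomialPair (pairIndexEquiv ι k)))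

theorem formDet_apply (φ : ι → Module.Dual ℝ (ℝ[X] × ℝ[X])) :
    formDet φ = (Matrix.of fun r k => φ r (monomialPair (pairIndexEquiv ι k))).det := rfl

theorem formDet_eq_zero_iff (φ : ι → Module.Dual ℝ (ℝ[X] × ℝ[X])) :
    formDet φ = 0 ↔ ∃ F ≠ 0, PairDegreeLT (Fintype.card ι) F ∧ ∀ r, φ r F = 0 := by
  rw [formDet_apply, ← Matrix.exists_mulVec_eq_zero_iff]
  have key : ∀ (r : ι) (y : ι → ℝ),
      (Matrix.of (fun r k => φ r (monomialPair (pairIndexEquiv ι k))) *ᵥ y) r =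
      φ r (∑ k, y ((pairIndexEquiv ι).symm k) • monomialPair k) := by
    intro r y
    rw [map_sum, ← Equiv.sum_comp (pairIndexEquiv ι)]
    simp [Matrix.mulVec, dotProduct, mul_comm]
  constructor
  · rintro ⟨y, hy, h⟩
    refine ⟨_, fun h0 => hy ?_, pairDegreeLT_sum fun k => y ((pairIndexEquiv ι).symm k),
      fun r => ?_⟩
    · have := sum_smul_monomialPair_eq_zero h0
      funext r
      simpa using congrFun this (pairIndexEquiv ι r)
    · rw [← key, h, Pi.zero_apply]
  · rintro ⟨F, hF, hd, h⟩
    rw [hd.eq_sum] at hF h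
    refine ⟨fun r => pairCoeff _ F (pairIndexEquiv ι r),
      fun h0 => hF ?_, ?_⟩
    · refine Finset.sum_eq_zero fun k _ => ?_
      have := congrFun h0 ((pairIndexEquiv ι).symm k)
      simp only [Equiv.apply_symm_apply, Pi.zero_apply] at this
      rw [this, zero_smul]
    · funext r
      rw [key]
      simpa using h r

end formDet

/-! ### Interpolating pairs and the Hermitian form of a set of nodes -/

section interpolation
variable {α : Type*} [DecidableEq α] (τ : α → ℝ) (c : α → ℝ × ℝ) (S : Finset α)

/-- The interpolation conditions at the nodes of `S`, followed by `m` further linear forms. -/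
noncomputable def dataForms {m : ℕ} (w : Fin m → Module.Dual ℝ (ℝ[X] × ℝ[X])) :
    S ⊕ Fin m → Module.Dual ℝ (ℝ[X] × ℝ[X]) :=
  Sum.elim (fun x => nodeForm (τ x) (c x)) w

/-- The determinant of the interpolation conditions at the nodes of `S` and of `m` further linear
forms, on the pairs with `|S| + m` coefficients. -/
noncomputable def bracket {m : ℕ} (w : Fin m → Module.Dual ℝ (ℝ[X] × ℝ[X])) : ℝ :=
  formDet (dataForms τ c S w)

theorem bracket_eq_zero_iff {m : ℕ} (w : Fin m → Module.Dual ℝ (ℝ[X] × ℝ[X])) :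
    bracket τ c S w = 0 ↔ ∃ F ≠ 0, PairDegreeLT (S.card + m) F ∧
      (∀ x ∈ S, nodeForm (τ x) (c x) F = 0) ∧ ∀ i, w i F = 0 := by
  simp [bracket, formDet_eq_zero_iff, dataForms]

/-- The bracket with one free row is the evaluation of that row at a pair of polynomials, whose
coefficients are the cofactors of the row. -/
theorem exists_interpolant : ∃ F : ℝ[X] × ℝ[X], PairDegreeLT (S.card + 1) F ∧
    ∀ w, w F = bracket τ c S ![w] := by
  let e := pairIndexEquiv (S ⊕ Fin 1)
  let M : S ⊕ Fin 1 → S ⊕ Fin 1 → ℝ := fun r k =>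
    dataForms τ c S ![0] r (monomialPair (e k))
  let l : (S ⊕ Fin 1 → ℝ) →ₗ[ℝ] ℝ :=
    Matrix.detRowAlternating.toMultilinearMap.toLinearMap M (Sum.inr 0)
  have hl : ∀ w : Module.Dual ℝ (ℝ[X] × ℝ[X]),
      bracket τ c S ![w] = l fun k => w (monomialPair (e k)) := by
    intro w
    change Matrix.det _ = Matrix.det _
    congr 1
    ext r k
    rcases r with x | i
    · have hne : (Sum.inl x : S ⊕ Fin 1) ≠ Sum.inr 0 := Sum.inl_ne_inr
      exact (congrFun (Function.update_of_ne hne _ M) k).symm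
    · obtain rfl : i = 0 := Subsingleton.elim _ _
      exact (congrFun (Function.update_self _ _ M) k).symm
  refine ⟨∑ k, l (Pi.single (e.symm k) 1) • monomialPair k, ?_, fun w => ?_⟩
  · have := pairDegreeLT_sum fun k => l (Pi.single (e.symm k) 1)
    simpa using this
  · rw [hl, map_sum, ← Equiv.sum_comp e, LinearMap.pi_apply_eq_sum_univ l]
    refine Finset.sum_congr rfl fun k _ => ?_
    rw [map_smul, Equiv.symm_apply_apply, smul_eq_mul, smul_eq_mul, mul_comm]
    congr 2
    ext j
    simp [Pi.single_apply, eq_comm]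

/-- The cofactor solution of the interpolation problem at the nodes of `S`. It is zero exactly when
the conditions are linearly dependent on the pairs with `|S| + 1` coefficients. -/
noncomputable def interpolant : ℝ[X] × ℝ[X] := (exists_interpolant τ c S).choose

theorem pairDegreeLT_interpolant : PairDegreeLT (S.card + 1) (interpolant τ c S) :=
  (exists_interpolant τ c S).choose_spec.1

theorem apply_interpolant (w : Module.Dual ℝ (ℝ[X] × ℝ[X])) :
    w (interpolant τ c S) = bracket τ c S ![w] :=
  (exists_interpolant τ c S).choose_spec.2 w

/-- The interpolant satisfies the conditions at the nodes of `S`, as a determinant with a repeated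
row vanishes. -/
theorem nodeForm_interpolant {x : α} (hx : x ∈ S) :
    nodeForm (τ x) (c x) (interpolant τ c S) = 0 := by
  rw [apply_interpolant]
  exact formDet.map_eq_zero_of_eq _ (i := Sum.inl ⟨x, hx⟩) (j := Sum.inr 0) rfl (by simp)

/-- The interpolant is nonzero if some further condition makes the interpolation problem uniquely
solvable. -/
theorem interpolant_ne_zero (w : Module.Dual ℝ (ℝ[X] × ℝ[X]))
    (h : ∀ F, PairDegreeLT (S.card + 1) F → (∀ x ∈ S, nodeForm (τ x) (c x) F = 0) → w F = 0 →
      F = 0) : interpolant τ c S ≠ 0 := by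
  intro h0
  have h1 := apply_interpolant τ c S w
  rw [h0, map_zero, eq_comm, bracket_eq_zero_iff] at h1
  obtain ⟨F, hF, hd, hn, hw⟩ := h1
  exact hF (h F hd hn (by simpa using hw))

/-- The bracket with two free rows, as a bilinear map of these rows. -/
noncomputable def bracketBilin : LinearMap.BilinMap ℝ (Module.Dual ℝ (ℝ[X] × ℝ[X])) ℝ :=
  have h0 : ∀ x y z, dataForms τ c S ![x, y] =
      Function.update (dataForms τ c S ![z, y]) (Sum.inr 0) x := by
    intro x y z; ext1 r; rcases r with r | i
    · simp [dataForms]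
    · fin_cases i <;> simp [dataForms]
  have h1 : ∀ x y z, dataForms τ c S ![x, y] =
      Function.update (dataForms τ c S ![x, z]) (Sum.inr 1) y := by
    intro x y z; ext1 r; rcases r with r | i
    · simp [dataForms]
    · fin_cases i <;> simp [dataForms]
  LinearMap.mk₂ ℝ (fun x y => bracket τ c S ![x, y])
    (fun x x' y => by
      simp only [bracket]
      rw [h0 (x + x') y 0, h0 x y 0, h0 x' y 0, formDet.map_update_add])
    (fun a x y => by
      simp only [bracket]
      rw [h0 (a • x) y 0, h0 x y 0, formDet.map_update_smul])
    (fun x y y' => by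
      simp only [bracket]
      rw [h1 x (y + y') 0, h1 x y 0, h1 x y' 0, formDet.map_update_add])
    (fun a x y => by
      simp only [bracket]
      rw [h1 x (a • y) 0, h1 x y 0, formDet.map_update_smul])

theorem bracketBilin_apply (x y : Module.Dual ℝ (ℝ[X] × ℝ[X])) :
    bracketBilin τ c S x y = bracket τ c S ![x, y] := rfl

theorem bracketBilin_self (x : Module.Dual ℝ (ℝ[X] × ℝ[X])) :
    bracketBilin τ c S x x = 0 :=
  formDet.map_eq_zero_of_eq _ (i := Sum.inr 0) (j := Sum.inr 1) rfl (by simp)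

theorem bracketBilin_swap (x y : Module.Dual ℝ (ℝ[X] × ℝ[X])) :
    bracketBilin τ c S y x = -bracketBilin τ c S x y := by
  have h := bracketBilin_self τ c S (x + y)
  simp only [map_add, LinearMap.add_apply, bracketBilin_self] at h
  linarith

/-- The real part of `imagForm u v`. -/
noncomputable def reForm (u v : ℂ) : Module.Dual ℝ (ℝ[X] × ℝ[X]) := Complex.reLm ∘ₗ imagForm u v

/-- The imaginary part of `imagForm u v`. -/
noncomputable def imForm (u v : ℂ) : Module.Dual ℝ (ℝ[X] × ℝ[X]) := Complex.imLm ∘ₗ imagForm u v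

/-- The form whose zeros `[u : v]` make up the circle of `S`: the determinant of the conditions at
the nodes of `S` and of the condition at `i` with value `[u : v]`. -/
noncomputable def hermForm (u v : ℂ) : ℝ := bracket τ c S ![reForm u v, imForm u v]

/-- `hermForm` is a Hermitian form in `(u, v)`, that is, a real linear combination of `|u|²`, `|v|²`
and the real and imaginary parts of `u * star v`. -/
theorem hermForm_eq (u v : ℂ) :
    hermForm τ c S u v =
      Complex.normSq u * bracket τ c S ![reForm 1 0, imForm 1 0] +
      Complex.normSq v * bracket τ c S ![reForm 0 1, imForm 0 1] +
      (u * star v).re *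
        (bracket τ c S ![reForm 1 0, imForm 0 1] - bracket τ c S ![imForm 1 0, reForm 0 1]) -
      (u * star v).im *
        (bracket τ c S ![reForm 1 0, reForm 0 1] + bracket τ c S ![imForm 1 0, imForm 0 1]) := by
  have hr : reForm u v = u.re • reForm 1 0 - u.im • imForm 1 0 + v.re • reForm 0 1
      - v.im • imForm 0 1 := by
    refine LinearMap.ext fun F => ?_
    simp [reForm, imForm]
    ring
  have hi : imForm u v = u.re • imForm 1 0 + u.im • reForm 1 0 + v.re • imForm 0 1
      + v.im • reForm 0 1 := by
    refine LinearMap.ext fun F => ?_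
    simp [reForm, imForm]
    ring
  simp only [hermForm, ← bracketBilin_apply]
  rw [hr, hi]
  simp only [map_add, map_sub, map_smul, LinearMap.add_apply, LinearMap.sub_apply,
    LinearMap.smul_apply, bracketBilin_self, smul_eq_mul]
  rw [bracketBilin_swap τ c S (reForm 1 0) (imForm 1 0),
    bracketBilin_swap τ c S (reForm 1 0) (reForm 0 1),
    bracketBilin_swap τ c S (reForm 1 0) (imForm 0 1),
    bracketBilin_swap τ c S (imForm 1 0) (reForm 0 1),
    bracketBilin_swap τ c S (imForm 1 0) (imForm 0 1),
    bracketBilin_swap τ c S (reForm 0 1) (imForm 0 1)]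
  simp [Complex.normSq_apply]
  ring

theorem hermForm_eq_zero_of_exists {u v : ℂ} {F : ℝ[X] × ℝ[X]} (hF : F ≠ 0)
    (hd : PairDegreeLT (S.card + 2) F) (hn : ∀ x ∈ S, nodeForm (τ x) (c x) F = 0)
    (h : imagForm u v F = 0) : hermForm τ c S u v = 0 := by
  refine (bracket_eq_zero_iff τ c S _).2 ⟨F, hF, hd, hn, ?_⟩
  rw [Fin.forall_fin_two]
  exact ⟨congrArg Complex.re h, congrArg Complex.im h⟩

theorem exists_of_hermForm_eq_zero {u v : ℂ} (h : hermForm τ c S u v = 0) :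
    ∃ F ≠ 0, PairDegreeLT (S.card + 2) F ∧ (∀ x ∈ S, nodeForm (τ x) (c x) F = 0) ∧
      imagForm u v F = 0 := by
  obtain ⟨F, hF, hd, hn, hw⟩ := (bracket_eq_zero_iff τ c S _).1 h
  rw [Fin.forall_fin_two] at hw
  exact ⟨F, hF, hd, hn, Complex.ext hw.1 hw.2⟩

/-- The first homogeneous coordinate `P(i)` of the point of `S`. -/
noncomputable def pointU : ℂ := aeval Complex.I (interpolant τ c S).1

/-- The second homogeneous coordinate `-Q(i)` of the point of `S`. -/
noncomputable def pointV : ℂ := -aeval Complex.I (interpolant τ c S).2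

theorem imagForm_point : imagForm (pointU τ c S) (pointV τ c S) (interpolant τ c S) = 0 := by
  simp [pointU, pointV]
  ring

theorem hermForm_zero : hermForm τ c S 0 0 = 0 := by
  rw [hermForm_eq]; simp

/-- The point of `b ∪ {x}` lies on the circle of `b`: the interpolant itself solves the system
of `b`. -/
theorem hermForm_point_of_insert {a b : Finset α} {x : α} (hx : x ∉ b) (hab : a = insert x b) :
    hermForm τ c b (pointU τ c a) (pointV τ c a) = 0 := by
  by_cases h : interpolant τ c a = 0
  · simp [pointU, pointV, h, hermForm_zero]
  · refine hermForm_eq_zero_of_exists τ c b h ?_ (fun y hy => ?_) (imagForm_point τ c a)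
    · have := pairDegreeLT_interpolant τ c a
      rwa [hab, Finset.card_insert_of_notMem hx, ← hab] at this
    · exact nodeForm_interpolant τ c a (by simp [hab, hy])

/-- The point of `a` lies on the circle of `a ∪ {x}`: the interpolant multiplied by `t - τ x` solves
the system of `a ∪ {x}`. -/
theorem hermForm_point_insert {a b : Finset α} {x : α} (hx : x ∉ a) (hab : b = insert x a) :
    hermForm τ c b (pointU τ c a) (pointV τ c a) = 0 := by
  by_cases h : interpolant τ c a = 0
  · simp [pointU, pointV, h, hermForm_zero]
  · set F := interpolant τ c a with hF
    have hX : (X - C (τ x) : ℝ[X]) ≠ 0 := X_sub_C_ne_zero _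
    refine hermForm_eq_zero_of_exists τ c b (F := ((X - C (τ x)) * F.1, (X - C (τ x)) * F.2))
      ?_ ?_ (fun y hy => ?_) ?_
    · intro h0
      apply h
      simpa [Prod.ext_iff, hX] using h0
    · obtain ⟨h1, h2⟩ := pairDegreeLT_interpolant τ c a
      rw [hab, Finset.card_insert_of_notMem hx]
      have key : ∀ {p : ℝ[X]} {n m : ℕ}, p.degree < (n : WithBot ℕ) → m = n + 1 →
          ((X - C (τ x)) * p).degree < (m : WithBot ℕ) := by
        rintro p n m hp rfl
        rcases eq_or_ne p 0 with rfl | h0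
        · rw [mul_zero, degree_zero]
          exact WithBot.bot_lt_coe _
        · rw [degree_mul, degree_X_sub_C, degree_eq_natDegree h0] at *
          norm_cast at *
          omega
      exact ⟨key h1 (by omega), key h2 (by omega)⟩
    · rw [hab, Finset.mem_insert] at hy
      rcases hy with rfl | hy
      · simp
      · have := nodeForm_interpolant τ c a hy
        simp only [nodeForm_apply, eval_mul, eval_sub, eval_X, eval_C] at this ⊢
        linear_combination (τ y - τ x) * this
    · have := imagForm_point τ c a
      simp only [imagForm_apply, map_mul] at this ⊢
      linear_combination (aeval Complex.I (X - C (τ x) : ℝ[X])) * this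

end interpolation

/-! ### Data with values zero and infinity -/

section witness
variable {α : Type*} [DecidableEq α] {τ : α → ℝ}

/-- Data with value `u/v = 0` at the nodes of `Z` and `∞` elsewhere. The conditions on `(P, Q)` then
decouple: `P` vanishes at the nodes of `Z` and `Q` at the others. -/
def zeroPoleData (Z : Finset α) (x : α) : ℝ × ℝ := if x ∈ Z then (0, 1) else (1, 0)

theorem nodeForm_zeroPoleData_iff (Z S : Finset α) (F : ℝ[X] × ℝ[X]) :
    (∀ x ∈ S, nodeForm (τ x) (zeroPoleData Z x) F = 0) ↔
      (∀ t ∈ (S ∩ Z).image τ, F.1.eval t = 0) ∧ ∀ t ∈ (S \ Z).image τ, F.2.eval t = 0 := by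
  simp only [Finset.forall_mem_image, Finset.mem_inter, Finset.mem_sdiff]
  constructor
  · intro h
    refine ⟨fun x hx => ?_, fun x hx => ?_⟩
    · simpa [zeroPoleData, hx.2] using h x hx.1
    · simpa [zeroPoleData, hx.2] using h x hx.1
  · rintro ⟨h1, h2⟩ x hx
    by_cases hZ : x ∈ Z
    · simpa [zeroPoleData, hZ] using h1 ⟨hx, hZ⟩
    · simpa [zeroPoleData, hZ] using h2 ⟨hx, hZ⟩

/-- The form of `S` is nonzero at `∞`: a solution `(P, Q)` would have `Q(i) = 0`, and `P` and `Q`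
would both have more zeros than their degrees allow. -/
theorem hermForm_zeroPoleData_left (hτ : Function.Injective τ) (Z S : Finset α)
    {l : ℕ} (hS : S.card = 2 * l + 1) (hZ : (S ∩ Z).card = l + 2)
    {u : ℂ} (hu : u ≠ 0) : hermForm τ (zeroPoleData Z) S u 0 ≠ 0 := by
  intro h
  obtain ⟨F, hF, ⟨hd1, hd2⟩, hn, hw⟩ := exists_of_hermForm_eq_zero _ _ _ h
  rw [nodeForm_zeroPoleData_iff] at hn
  have hI : aeval Complex.I F.2 = 0 := by simpa [hu] using hw
  have hc := Finset.card_inter_add_card_sdiff S Z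
  have h1 := eq_zero_of_degree_lt_of_eval_finset_eq_zero _
    (by rw [Finset.card_image_of_injective _ hτ]; exact hd1.trans_le (by norm_cast; omega)) hn.1
  have h2 := eq_zero_of_aeval_I_eq_zero _ hn.2 hI
    (by rw [Finset.card_image_of_injective _ hτ]; exact hd2.trans_le (by norm_cast; omega))
  exact hF (Prod.ext h1 h2)

/-- The form of `S` is nonzero at `0`: a solution `(P, Q)` would have `P(i) = 0`, and `P` and `Q`
would both have more zeros than their degrees allow. -/
theorem hermForm_zeroPoleData_right (hτ : Function.Injective τ) (Z S : Finset α)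
    {l : ℕ} (hS : S.card = 2 * l + 1) (hZ : (S ∩ Z).card = l)
    {v : ℂ} (hv : v ≠ 0) : hermForm τ (zeroPoleData Z) S 0 v ≠ 0 := by
  intro h
  obtain ⟨F, hF, ⟨hd1, hd2⟩, hn, hw⟩ := exists_of_hermForm_eq_zero _ _ _ h
  rw [nodeForm_zeroPoleData_iff] at hn
  have hI : aeval Complex.I F.1 = 0 := by simpa [hv] using hw
  have hc := Finset.card_inter_add_card_sdiff S Z
  have h1 := eq_zero_of_aeval_I_eq_zero _ hn.1 hI
    (by rw [Finset.card_image_of_injective _ hτ]; exact hd1.trans_le (by norm_cast; omega))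
  have h2 := eq_zero_of_degree_lt_of_eval_finset_eq_zero _
    (by rw [Finset.card_image_of_injective _ hτ]; exact hd2.trans_le (by norm_cast; omega)) hn.2
  exact hF (Prod.ext h1 h2)

/-- The point of `S` is `∞`: the zeros force `Q = 0`, and all zeros of the nonzero polynomial `P`
are real. -/
theorem point_zeroPoleData_left (hτ : Function.Injective τ) (Z S : Finset α)
    {k : ℕ} (hS : S.card = 2 * k) (hZ : (S ∩ Z).card = k) :
    pointU τ (zeroPoleData Z) S ≠ 0 ∧ pointV τ (zeroPoleData Z) S = 0 := by
  have hc := Finset.card_inter_add_card_sdiff S Z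
  have h2 : ∀ F : ℝ[X] × ℝ[X], PairDegreeLT (S.card + 1) F →
      (∀ x ∈ S, nodeForm (τ x) (zeroPoleData Z x) F = 0) → F.2 = 0 := by
    intro F hd hn
    rw [nodeForm_zeroPoleData_iff] at hn
    exact eq_zero_of_degree_lt_of_eval_finset_eq_zero _
      (by rw [Finset.card_image_of_injective _ hτ]; exact hd.2.trans_le (by norm_cast; omega)) hn.2
  obtain ⟨t, ht⟩ := Infinite.exists_notMem_finset ((S ∩ Z).image τ)
  have h0 : interpolant τ (zeroPoleData Z) S ≠ 0 := by
    refine interpolant_ne_zero τ _ S (nodeForm t (0, 1)) fun F hd hn hw => ?_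
    refine Prod.ext ?_ (h2 F hd hn)
    rw [nodeForm_zeroPoleData_iff] at hn
    refine eq_zero_of_degree_lt_of_eval_finset_eq_zero (insert t ((S ∩ Z).image τ)) ?_ ?_
    · rw [Finset.card_insert_of_notMem ht, Finset.card_image_of_injective _ hτ]
      exact hd.1.trans_le (by norm_cast; omega)
    · rw [Finset.forall_mem_insert]
      exact ⟨by simpa using hw, hn.1⟩
  have hd := pairDegreeLT_interpolant τ (zeroPoleData Z) S
  have hn := fun x (hx : x ∈ S) => nodeForm_interpolant τ (zeroPoleData Z) S hx
  have hF2 := h2 _ hd hn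
  rw [nodeForm_zeroPoleData_iff] at hn
  refine ⟨fun hu => h0 (Prod.ext ?_ hF2), by simp [pointV, hF2]⟩
  exact eq_zero_of_aeval_I_eq_zero _ hn.1 hu
    (by rw [Finset.card_image_of_injective _ hτ]; exact hd.1.trans_le (by norm_cast; omega))

/-- The point of `S` is `0`: the zeros force `P = 0`, and all zeros of the nonzero polynomial `Q`
are real. -/
theorem point_zeroPoleData_right (hτ : Function.Injective τ) (Z S : Finset α)
    {k : ℕ} (hS : S.card = 2 * k) (hZ : (S ∩ Z).card = k + 1) :
    pointU τ (zeroPoleData Z) S = 0 ∧ pointV τ (zeroPoleData Z) S ≠ 0 := by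
  have hc := Finset.card_inter_add_card_sdiff S Z
  have h1 : ∀ F : ℝ[X] × ℝ[X], PairDegreeLT (S.card + 1) F →
      (∀ x ∈ S, nodeForm (τ x) (zeroPoleData Z x) F = 0) → F.1 = 0 := by
    intro F hd hn
    rw [nodeForm_zeroPoleData_iff] at hn
    exact eq_zero_of_degree_lt_of_eval_finset_eq_zero _
      (by rw [Finset.card_image_of_injective _ hτ]; exact hd.1.trans_le (by norm_cast; omega)) hn.1
  obtain ⟨t, ht⟩ := Infinite.exists_notMem_finset ((S \ Z).image τ)
  have h0 : interpolant τ (zeroPoleData Z) S ≠ 0 := by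
    refine interpolant_ne_zero τ _ S (nodeForm t (1, 0)) fun F hd hn hw => ?_
    refine Prod.ext (h1 F hd hn) ?_
    rw [nodeForm_zeroPoleData_iff] at hn
    refine eq_zero_of_degree_lt_of_eval_finset_eq_zero (insert t ((S \ Z).image τ)) ?_ ?_
    · rw [Finset.card_insert_of_notMem ht, Finset.card_image_of_injective _ hτ]
      exact hd.2.trans_le (by norm_cast; omega)
    · rw [Finset.forall_mem_insert]
      exact ⟨by simpa using hw, hn.2⟩
  have hd := pairDegreeLT_interpolant τ (zeroPoleData Z) S
  have hn := fun x (hx : x ∈ S) => nodeForm_interpolant τ (zeroPoleData Z) S hx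
  have hF1 := h1 _ hd hn
  rw [nodeForm_zeroPoleData_iff] at hn
  refine ⟨by simp [pointU, hF1], fun hv => h0 (Prod.ext hF1 ?_)⟩
  exact eq_zero_of_aeval_I_eq_zero _ hn.2 (by simpa [pointV] using hv)
    (by rw [Finset.card_image_of_injective _ hτ]; exact hd.2.trans_le (by norm_cast; omega))

/-- The incidence determinant of `a` and `b` does not vanish for all data if `a` and `b` differ by
at least three elements. -/
theorem exists_hermForm_point_ne_zero (hτ : Function.Injective τ)
    {a b : Finset α} (ha : Even a.card) (hb : Odd b.card)
    (hab : 3 ≤ (a \ b).card + (b \ a).card) :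
    ∃ c, hermForm τ c b (pointU τ c a) (pointV τ c a) ≠ 0 := by
  obtain ⟨k, hk⟩ := ha.exists_two_nsmul
  obtain ⟨l, hl⟩ := hb
  rw [smul_eq_mul] at hk
  have hca := Finset.card_inter_add_card_sdiff a b
  have hcb := Finset.card_inter_add_card_sdiff b a
  rw [Finset.inter_comm] at hcb
  rcases Nat.eq_zero_or_pos k with hk0 | hk0
  · -- The point of `∅` is always `∞`, so the form of `b` has to be nonzero there.
    subst hk0
    obtain rfl : a = ∅ := by simpa using hk
    obtain ⟨Z, hZ, hZc⟩ := Finset.exists_subset_card_eq (s := b) (n := l + 2)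
      (by simp at hab; omega)
    obtain ⟨hu, hv⟩ := point_zeroPoleData_left hτ Z ∅ (k := 0) (by simp) (by simp)
    refine ⟨zeroPoleData Z, ?_⟩
    rw [hv]
    exact hermForm_zeroPoleData_left hτ Z b hl (by rwa [Finset.inter_eq_right.2 hZ]) hu
  · -- With `k + 1` elements of `a` and `l` elements of `b` in `Z`, the point of `a` is `0`, and the
    -- form of `b` is nonzero there. Here `x` is the least possible size of `Z ∩ a ∩ b`; that it
    -- does not exceed `l` is where the lower bound on the difference of `a` and `b` enters.
    set m := (a ∩ b).card with hm
    obtain ⟨x, hx⟩ : ∃ x, x = max (m + 1 - k) (m - l - 1) := ⟨_, rfl⟩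
    obtain ⟨Z₀, hZ₀, hc₀⟩ := Finset.exists_subset_card_eq (s := a ∩ b) (n := x) (by omega)
    obtain ⟨Z₁, hZ₁, hc₁⟩ := Finset.exists_subset_card_eq (s := a \ b) (n := k + 1 - x) (by omega)
    obtain ⟨Z₂, hZ₂, hc₂⟩ := Finset.exists_subset_card_eq (s := b \ a) (n := l - x) (by omega)
    have hZa : a ∩ (Z₀ ∪ Z₁ ∪ Z₂) = Z₀ ∪ Z₁ := by
      ext y
      have h0 := @hZ₀ y; have h1 := @hZ₁ y; have h2 := @hZ₂ y
      simp only [Finset.mem_inter, Finset.mem_sdiff, Finset.mem_union] at *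
      tauto
    have hZb : b ∩ (Z₀ ∪ Z₁ ∪ Z₂) = Z₀ ∪ Z₂ := by
      ext y
      have h0 := @hZ₀ y; have h1 := @hZ₁ y; have h2 := @hZ₂ y
      simp only [Finset.mem_inter, Finset.mem_sdiff, Finset.mem_union] at *
      tauto
    have hd1 : Disjoint Z₀ Z₁ := Finset.disjoint_left.2 fun y h h' =>
      (Finset.mem_sdiff.1 (hZ₁ h')).2 (Finset.mem_inter.1 (hZ₀ h)).2
    have hd2 : Disjoint Z₀ Z₂ := Finset.disjoint_left.2 fun y h h' =>
      (Finset.mem_sdiff.1 (hZ₂ h')).2 (Finset.mem_inter.1 (hZ₀ h)).1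
    obtain ⟨hu, hv⟩ := point_zeroPoleData_right hτ (Z₀ ∪ Z₁ ∪ Z₂) a hk
      (by rw [hZa, Finset.card_union_of_disjoint hd1]; omega)
    refine ⟨zeroPoleData (Z₀ ∪ Z₁ ∪ Z₂), ?_⟩
    rw [hu]
    exact hermForm_zeroPoleData_right hτ _ b hl
      (by rw [hZb, Finset.card_union_of_disjoint hd2]; omega) hv

end witness

/-! ### Generic data -/

section generic
variable {α : Type*}

/-- A continuous function of the data that is real analytic along every line. Such functions obey
the identity principle, and for infinite `α` no norm on the space of data is needed. -/
structure IsLineAnalytic (g : (α → ℝ × ℝ) → ℝ) : Prop where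
  continuous : Continuous g
  analytic : ∀ c d : α → ℝ × ℝ, AnalyticOnNhd ℝ (fun t : ℝ => g (c + t • d)) Set.univ

theorem IsLineAnalytic.dense_ne_zero {g : (α → ℝ × ℝ) → ℝ} (hg : IsLineAnalytic g)
    (h : ∃ c, g c ≠ 0) : Dense {c | g c ≠ 0} := by
  obtain ⟨d, hd⟩ := h
  intro c
  by_contra hc
  have hlim : Filter.Tendsto (fun t : ℝ => c + t • (d - c)) (nhds 0) (nhds c) := by
    have : Continuous fun t : ℝ => c + t • (d - c) := by fun_prop
    simpa using this.tendsto 0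
  have hev : ∀ᶠ t in nhds (0 : ℝ), g (c + t • (d - c)) = 0 := by
    have : {c | g c ≠ 0}ᶜ ∈ nhds c := by
      rw [← mem_interior_iff_mem_nhds, interior_compl]
      exact hc
    filter_upwards [hlim this] with t ht
    simpa using ht
  have := (hg.analytic c (d - c)).eqOn_zero_of_preconnected_of_eventuallyEq_zero
    isPreconnected_univ (Set.mem_univ 0) hev (Set.mem_univ 1)
  exact hd (by simpa using this)

variable [DecidableEq α] (τ : α → ℝ)

theorem isLineAnalytic_bracket (S : Finset α) {m : ℕ}
    (w : Fin m → Module.Dual ℝ (ℝ[X] × ℝ[X])) : IsLineAnalytic fun c => bracket τ c S w := by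
  simp only [bracket, formDet_apply]
  constructor
  · refine Continuous.matrix_det (continuous_matrix fun r k => ?_)
    rcases r with x | i
    · simp only [dataForms, Matrix.of_apply, Sum.elim_inl, nodeForm_apply]
      fun_prop
    · simp only [dataForms, Matrix.of_apply, Sum.elim_inr]
      fun_prop
  · intro c d t _
    simp only [Matrix.det_apply']
    refine Finset.analyticAt_fun_sum _ fun σ _ => ?_
    refine analyticAt_const.fun_mul (Finset.analyticAt_fun_prod _ fun k _ => ?_)
    rcases σ k with x | i
    · simp only [dataForms, Matrix.of_apply, Sum.elim_inl, nodeForm_apply, Pi.add_apply,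
        Pi.smul_apply, Prod.fst_add, Prod.snd_add, Prod.smul_fst, Prod.smul_snd, smul_eq_mul]
      fun_prop
    · simp only [dataForms, Matrix.of_apply, Sum.elim_inr]
      fun_prop

/-- The incidence determinant of `a` and `b` is analytic in the data, being a polynomial in
brackets. -/
theorem isLineAnalytic_hermForm_point (a b : Finset α) :
    IsLineAnalytic fun c => hermForm τ c b (pointU τ c a) (pointV τ c a) := by
  have h1 : ∀ c, (pointU τ c a).re = bracket τ c a ![reForm 0 1] := fun c => by
    rw [← apply_interpolant]; simp [reForm, pointU]
  have h2 : ∀ c, (pointU τ c a).im = bracket τ c a ![imForm 0 1] := fun c => by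
    rw [← apply_interpolant]; simp [imForm, pointU]
  have h3 : ∀ c, (pointV τ c a).re = -bracket τ c a ![reForm 1 0] := fun c => by
    rw [← apply_interpolant]; simp [reForm, pointV]
  have h4 : ∀ c, (pointV τ c a).im = -bracket τ c a ![imForm 1 0] := fun c => by
    rw [← apply_interpolant]; simp [imForm, pointV]
  have hc := fun (S : Finset α) (m : ℕ) (w : Fin m → Module.Dual ℝ (ℝ[X] × ℝ[X])) =>
    (isLineAnalytic_bracket τ S w).continuous
  have ha := fun (S : Finset α) (m : ℕ) (w : Fin m → Module.Dual ℝ (ℝ[X] × ℝ[X])) c d t =>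
    (isLineAnalytic_bracket τ S w).analytic c d t (Set.mem_univ t)
  simp only [hermForm_eq, Complex.normSq_apply, Complex.mul_re, Complex.mul_im, Complex.star_def,
    Complex.conj_re, Complex.conj_im, h1, h2, h3, h4]
  constructor
  · fun_prop
  · intro c d t _
    fun_prop

theorem exists_generic_data [Countable α] (hτ : Function.Injective τ) :
    ∃ c : α → ℝ × ℝ, ∀ a b : Finset α, Even a.card → Odd b.card →
      3 ≤ (a \ b).card + (b \ a).card →
      hermForm τ c b (pointU τ c a) (pointV τ c a) ≠ 0 := by
  let I := {p : Finset α × Finset α // Even p.1.card ∧ Odd p.2.card ∧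
    3 ≤ (p.1 \ p.2).card + (p.2 \ p.1).card}
  have hd : Dense (⋂ p : I,
      {c | hermForm τ c p.1.2 (pointU τ c p.1.1) (pointV τ c p.1.1) ≠ 0}) := by
    refine dense_iInter_of_isOpen (fun p => ?_) fun p => ?_
    · exact isOpen_ne_fun (isLineAnalytic_hermForm_point τ p.1.1 p.1.2).continuous continuous_const
    · exact (isLineAnalytic_hermForm_point τ p.1.1 p.1.2).dense_ne_zero
        (exists_hermForm_point_ne_zero hτ p.2.1 p.2.2.1 p.2.2.2)
  obtain ⟨c, hc⟩ := hd.nonempty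
  refine ⟨c, fun a b ha hb hab => ?_⟩
  exact Set.mem_iInter.1 hc ⟨(a, b), ha, hb, hab⟩

end generic

/-! ### Symmetric differences of finite sets -/

section combinatorics
variable {α : Type*} [DecidableEq α]

theorem card_symmDiff_eq (a b : Finset α) : (a ∆ b).card = (a \ b).card + (b \ a).card :=
  Finset.card_union_of_disjoint disjoint_sdiff_sdiff

theorem card_symmDiff_add (a b : Finset α) :
    (a ∆ b).card + 2 * (a ∩ b).card = a.card + b.card := by
  rw [card_symmDiff_eq, ← Finset.card_inter_add_card_sdiff a b,
    ← Finset.card_inter_add_card_sdiff b a, Finset.inter_comm b a]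
  ring

theorem even_card_symmDiff (a b : Finset α) :
    Even (a ∆ b).card ↔ (Even a.card ↔ Even b.card) := by
  have h := card_symmDiff_add a b
  simp only [Nat.even_iff]
  omega

theorem covBy_or_covBy_iff (a b : Finset α) : a ⋖ b ∨ b ⋖ a ↔ (a ∆ b).card = 1 := by
  rw [Finset.covBy_iff_card_sdiff_eq_one, Finset.covBy_iff_card_sdiff_eq_one, card_symmDiff_eq,
    ← Finset.sdiff_eq_empty_iff_subset, ← Finset.sdiff_eq_empty_iff_subset, ← Finset.card_eq_zero,
    ← Finset.card_eq_zero]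
  omega

/-- In the graph of the Cox configuration, a vertex `a` is determined by its neighbours. If
`a ≠ a'`, the hypothesis for `x ∈ a ∆ a'` shows that `a ∆ a'` has two elements, and then it fails for a
third element of `α`. -/
theorem eq_of_card_symmDiff_singleton (hα : 3 ≤ ENat.card α) {a a' : Finset α}
    (ha : Even a.card ↔ Even a'.card) (h : ∀ x, (a ∆ (a' ∆ {x})).card = 1) : a = a' := by
  simp only [← symmDiff_assoc] at h
  rw [← even_card_symmDiff] at ha
  rw [← symmDiff_eq_bot]
  generalize a ∆ a' = d at ha h
  by_contra hd
  obtain ⟨x, hx⟩ := Finset.nonempty_iff_ne_empty.2 hd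
  have hc := card_symmDiff_add d {x}
  rw [h x, Finset.inter_singleton_of_mem hx, Finset.card_singleton] at hc
  obtain ⟨y, y', -, rfl⟩ := Finset.card_eq_two.1 (by omega : d.card = 2)
  obtain ⟨z, hz, hz'⟩ := ENat.exists_ne_ne_of_three_le hα y y'
  have hc' := card_symmDiff_add {y, y'} {z}
  rw [h z, Finset.inter_singleton_of_notMem (by simp [hz, hz']), Finset.card_singleton] at hc'
  simp only [Finset.card_empty] at hc'
  omega

theorem exists_card_eq_three (hα : 3 ≤ ENat.card α) : ∃ d : Finset α, d.card = 3 := by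
  have hpos : 0 < ENat.card α := lt_of_lt_of_le (by norm_num) hα
  obtain ⟨x⟩ := (ENat.card_pos_iff_nonempty α).1 hpos
  obtain ⟨y, hy, -⟩ := ENat.exists_ne_ne_of_three_le hα x x
  obtain ⟨z, hz, hz'⟩ := ENat.exists_ne_ne_of_three_le hα x y
  exact ⟨{x, y, z}, Finset.card_eq_three.2 ⟨x, y, z, hy.symm, hz.symm, hz'.symm, rfl⟩⟩

end combinatorics

/-! ### Points and circles of the sphere -/

section realization
open EuclideanGeometry

theorem isCircleOn_setOf_inner_add_eq_zero {S : Sphere (EuclideanSpace ℝ (Fin 3))}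
    {n : EuclideanSpace ℝ (Fin 3)} {d : ℝ} (hn : n ≠ 0)
    (h : {x | ⟪n, x⟫_ℝ + d = 0 ∧ x ∈ S}.Nontrivial) :
    IsCircleOn S {x | ⟪n, x⟫_ℝ + d = 0 ∧ x ∈ S} := by
  refine ⟨h, ?_⟩
  obtain ⟨p, hp, -⟩ := h.nonempty
  have : Fact (Module.finrank ℝ (EuclideanSpace ℝ (Fin 3)) = 2 + 1) := ⟨by simp⟩
  refine ⟨AffineSubspace.mk' p (ℝ ∙ n)ᗮ, ?_, ?_⟩
  · rw [AffineSubspace.direction_mk', Submodule.finrank_orthogonal_span_singleton (n := 2) hn]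
  · ext x
    rw [Set.mem_ofPred_eq, Set.mem_ofPred_eq, AffineSubspace.mem_mk',
      Submodule.mem_orthogonal_singleton_iff_inner_right, vsub_eq_sub, inner_sub_right]
    have : ⟪n, x⟫_ℝ + d = 0 ↔ ⟪n, x⟫_ℝ - ⟪n, p⟫_ℝ = 0 := by
      constructor <;> intro h <;> linarith
    rw [this]

/-- Maps from points to vectors of a sphere and from blocks to equations of planes that respect
incidence in both directions give a realization; injectivity and nondegeneracy are automatic. -/
theorem nonempty_realization {X : Type*} (hX : 3 ≤ ENat.card X)
    {S : Sphere (EuclideanSpace ℝ (Fin 3))}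
    (f : {a : Finset X // Even a.card} → EuclideanSpace ℝ (Fin 3)) (hf : ∀ a, f a ∈ S)
    (n : {b : Finset X // Odd b.card} → EuclideanSpace ℝ (Fin 3))
    (d : {b : Finset X // Odd b.card} → ℝ)
    (h : ∀ a b, a.1 ⋖ b.1 ∨ b.1 ⋖ a.1 ↔ ⟪n b, f a⟫_ℝ + d b = 0) :
    Nonempty ((coxConfiguration X).Realization (sphereCircles S)) := by
  classical
  have hinc : ∀ a b, (a.1 ∆ b.1).card = 1 ↔ ⟪n b, f a⟫_ℝ + d b = 0 := fun a b => by
    rw [← h, covBy_or_covBy_iff]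
  have hf_inj : Function.Injective f := by
    intro a a' haa
    refine Subtype.ext (eq_of_card_symmDiff_singleton hX (by simp [a.2, a'.2]) fun x => ?_)
    have hb : Odd (a'.1 ∆ {x}).card := by
      rw [← Nat.not_even_iff_odd, even_card_symmDiff]
      simp [a'.2]
    refine (hinc a ⟨_, hb⟩).2 ?_
    rw [haa, ← hinc]
    simp
  have hpoint : ∀ (b : {b : Finset X // Odd b.card}) (x : X), Even (b.1 ∆ {x}).card := by
    intro b x
    rw [even_card_symmDiff]
    simp [Nat.not_even_iff_odd.2 b.2]
  have hpoint_inc : ∀ (b : {b : Finset X // Odd b.card}) (x : X),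
      ((⟨b.1 ∆ {x}, hpoint b x⟩ : {a : Finset X // Even a.card}).1 ∆ b.1).card = 1 := by
    intro b x
    simp
  obtain ⟨t, ht⟩ := exists_card_eq_three hX
  obtain ⟨x, y, z, hxy, -⟩ := Finset.card_eq_three.1 ht
  have hcircle : ∀ b, IsCircleOn S {x | ⟪n b, x⟫_ℝ + d b = 0 ∧ x ∈ S} := by
    intro b
    have hx := (hinc _ b).1 (hpoint_inc b x)
    have hy := (hinc _ b).1 (hpoint_inc b y)
    refine isCircleOn_setOf_inner_add_eq_zero (fun hn => ?_)
      ⟨_, ⟨hx, hf _⟩, _, ⟨hy, hf _⟩, fun hxy' => hxy ?_⟩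
    · -- With a zero normal vector the equation would not depend on the point. But it holds at a
      -- point incident with `b` and fails at the point of `b ∆ t`.
      have hev : Even (b.1 ∆ t).card := by
        rw [even_card_symmDiff, ht]
        simp [Nat.not_even_iff_odd.2 b.2]
        decide
      have := (hinc ⟨_, hev⟩ b).2 (by rw [hn, inner_zero_left] at hx ⊢; exact hx)
      simp [ht] at this
    · simpa using congrArg Subtype.val (hf_inj hxy')
  refine ⟨⟨fun a => ⟨f a, hf a⟩, fun b => ⟨_, hcircle b⟩, ?_, ?_, ?_⟩⟩
  · intro a a' haa
    exact hf_inj (congrArg Subtype.val haa)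
  · intro b b' hbb
    refine Subtype.ext (eq_of_card_symmDiff_singleton hX
      (by simp [Nat.not_even_iff_odd.2 b.2, Nat.not_even_iff_odd.2 b'.2]) fun x => ?_)
    rw [symmDiff_comm]
    refine (hinc ⟨_, hpoint b' x⟩ b).2 ?_
    have hmem := (hinc _ b').1 (hpoint_inc b' x)
    have hset : {x | ⟪n b, x⟫_ℝ + d b = 0 ∧ x ∈ S} = {x | ⟪n b', x⟫_ℝ + d b' = 0 ∧ x ∈ S} :=
      congrArg Subtype.val hbb
    have : f ⟨_, hpoint b' x⟩ ∈ {x | ⟪n b, x⟫_ℝ + d b = 0 ∧ x ∈ S} := by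
      rw [hset]
      exact ⟨hmem, hf _⟩
    exact this.1
  · intro a b
    exact (h a b).trans ⟨fun hab => ⟨hab, hf a⟩, fun hab => hab.1⟩

/-- The Hopf map: the point of the unit sphere that corresponds to `[u : v]` in the complex
projective line. For `u = v = 0` it has the junk value `0`. -/
noncomputable def hopf (u v : ℂ) : EuclideanSpace ℝ (Fin 3) :=
  (Complex.normSq u + Complex.normSq v)⁻¹ •
    !₂[2 * (u * star v).re, 2 * (u * star v).im, Complex.normSq u - Complex.normSq v]

theorem norm_hopf {u v : ℂ} (h : Complex.normSq u + Complex.normSq v ≠ 0) : ‖hopf u v‖ = 1 := by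
  have h0 : 0 < Complex.normSq u + Complex.normSq v :=
    lt_of_le_of_ne (add_nonneg (Complex.normSq_nonneg u) (Complex.normSq_nonneg v)) h.symm
  rw [hopf, norm_smul, norm_inv, Real.norm_of_nonneg h0.le, inv_mul_eq_one₀ h,
    EuclideanSpace.norm_eq, eq_comm, Real.sqrt_eq_iff_mul_self_eq_of_pos h0]
  simp [Fin.sum_univ_three, Complex.normSq_apply]
  ring

/-- Up to a positive factor, a Hermitian form in `(u, v)` is an affine function of `hopf u v`. -/
theorem hermitian_eq_inner_hopf {u v : ℂ} (h : Complex.normSq u + Complex.normSq v ≠ 0)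
    (p q r s : ℝ) :
    Complex.normSq u * p + Complex.normSq v * q + (u * star v).re * r - (u * star v).im * s =
      (Complex.normSq u + Complex.normSq v) / 2 * (⟪!₂[r, -s, p - q], hopf u v⟫_ℝ + (p + q)) := by
  simp only [hopf, inner_smul_right, PiLp.inner_apply, Fin.sum_univ_three]
  simp
  field_simp
  ring

end realization

/-! ### The realization -/

theorem mainTheorem1 {X : Type*} [Countable X] (hX : 3 ≤ ENat.card X) :
    ∃ S : EuclideanGeometry.Sphere (EuclideanSpace ℝ (Fin 3)), 0 < S.radius ∧
      Nonempty ((coxConfiguration X).Realization (sphereCircles S)) := by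
  classical
  obtain ⟨e, he⟩ := exists_injective_nat X
  obtain ⟨τ, hτ⟩ : ∃ τ : X → ℝ, Function.Injective τ :=
    ⟨fun x => e x, Nat.cast_injective.comp he⟩
  obtain ⟨c, hc⟩ := exists_generic_data τ hτ
  have hinc : ∀ (a : {a : Finset X // Even a.card}) (b : {b : Finset X // Odd b.card}),
      a.1 ⋖ b.1 ∨ b.1 ⋖ a.1 ↔
        hermForm τ c b.1 (pointU τ c a.1) (pointV τ c a.1) = 0 := by
    intro a b
    constructor
    · rintro (hab | hab)
      · obtain ⟨x, hx, hxb⟩ := hab.exists_finset_insert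
        exact hermForm_point_insert τ c hx hxb.symm
      · obtain ⟨x, hx, hxa⟩ := hab.exists_finset_insert
        exact hermForm_point_of_insert τ c hx hxa.symm
    · intro h0
      by_contra hab
      refine hc a.1 b.1 a.2 b.2 ?_ h0
      have h1 : (a.1 ∆ b.1).card ≠ 1 := fun h => hab ((covBy_or_covBy_iff _ _).2 h)
      have h2 : ¬ Even (a.1 ∆ b.1).card := by
        rw [even_card_symmDiff]
        simp [a.2, Nat.not_even_iff_odd.2 b.2]
      rw [← card_symmDiff_eq]
      rw [Nat.even_iff] at h2
      omega
  obtain ⟨t, ht⟩ := exists_card_eq_three hX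
  -- The form of `b` vanishes at `(0, 0)`, so a point without homogeneous coordinates would be
  -- incident with all blocks, also with `a ∆ t`.
  have hne : ∀ a : {a : Finset X // Even a.card},
      Complex.normSq (pointU τ c a.1) + Complex.normSq (pointV τ c a.1) ≠ 0 := by
    intro a h0
    have hu := Complex.normSq_nonneg (pointU τ c a.1)
    have hv := Complex.normSq_nonneg (pointV τ c a.1)
    have hu0 : pointU τ c a.1 = 0 := Complex.normSq_eq_zero.1 (by linarith)
    have hv0 : pointV τ c a.1 = 0 := Complex.normSq_eq_zero.1 (by linarith)
    have hodd : Odd (a.1 ∆ t).card := by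
      rw [← Nat.not_even_iff_odd, even_card_symmDiff, ht]
      simp [a.2]
      decide
    have := (hinc a ⟨_, hodd⟩).2 (by rw [hu0, hv0, hermForm_zero])
    have := (covBy_or_covBy_iff _ _).1 this
    simp [ht] at this
  refine ⟨⟨0, 1⟩, one_pos, nonempty_realization hX
    (fun a => hopf (pointU τ c a.1) (pointV τ c a.1)) (fun a => ?_) ?_ ?_ fun a b => ?_⟩
  · rw [EuclideanGeometry.mem_sphere, dist_zero_right, norm_hopf (hne a)]
  rotate_left 2
  · rw [hinc, hermForm_eq, hermitian_eq_inner_hopf (hne a), mul_eq_zero, or_iff_right]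
    exact div_ne_zero (hne a) two_ne_zero
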